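/- Let $P,V,N$ be random vectors in $\mathbb R^3$ and $\varepsilon$ a real random variable on a common probability space. Assume that $P$ (target position) and $V$ (target velocity) are jointly Gaussian with $$\mathbb E[P]=\mathbb E[V]=0,\quad \operatorname{Cov}(P)=\sigma_P^2I_3,\quad \operatorname{Cov}(V)=\sigma_V^2I_3,\quad \operatorname{Cov}(V,P)=\rho I_3,\quad \rho\neq 0,$$ that $N\sim\mathcal N(0,\sigma_N^2I_3)$ with $\sigma_N>0$ and $\varepsilon\sim\mathcal N(0,\sigma_\varepsilon^2)$, and that $(P,V)$, $N$, $\varepsilon$ are mutually independent. The observation is $Z=(Y,S)\in\mathbb R^3\times\mathbb R$, where $$Y=P+N,\qquad S=u(P)^\top V+\varepsilon,\qquad u(p)=p/\|p\|.$$ Let $\mathcal F_{\mathrm{aff}}$ be the set of all maps $f:\mathbb R^3\times\mathbb R\to\mathbb R^3$ of the form $f(y,s)=a+Ay+bs$ with $a,b\in\mathbb R^3$ and $A\in\mathbb R^{3\times 3}$. Then the Bayes estimator $g^*(Z)=\mathbb E[P\mid Z]$ is not affine, that is, there is no $f\in\mathcal F_{\mathrm{aff}}$ with $g^*(Z)=f(Z)$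 almost surely. Consequently, $$\inf_{f\in\mathcal F_{\mathrm{aff}}}\mathbb E\|P-f(Z)\|^2>\mathbb E\|P-g^*(Z)\|^2 .$$ -/

import Mathlib

open MeasureTheory ProbabilityTheory

noncomputable section

namespace Doppler

/-- Three-dimensional Euclidean space. -/
abbrev E3 : Type := EuclideanSpace ℝ (Fin 3)

/-- The `3 × 3` cross-covariance matrix `Cov(X, Y)`, with entries `Cov(X i, Y j)`. -/
def covMatrix {Ω : Type*} [MeasurableSpace Ω] (μ : Measure Ω) (X Y : Ω → E3) :
    Matrix (Fin 3) (Fin 3) ℝ :=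
  Matrix.of fun i j => cov[fun ω => X ω i, fun ω => Y ω j; μ]

/-- The line-of-sight direction `u(p) = p / ‖p‖`. -/
def lineOfSight (p : E3) : E3 := ‖p‖⁻¹ • p

/-- The observation `Z = (Y, S)`, with `Y = P + N` and `S = u(P)ᵀ V + ε`. -/
def observation {Ω : Type*} (P V N : Ω → E3) (ε : Ω → ℝ) (ω : Ω) : E3 × ℝ :=
  (P ω + N ω, inner ℝ (lineOfSight (P ω)) (V ω) + ε ω)

/-- The affine estimators `f(y, s) = a + A y + b s`. -/
def affineEstimators : Set (E3 × ℝ → E3) :=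
  {f | ∃ (a b : E3) (A : Matrix (Fin 3) (Fin 3) ℝ),
    ∀ (y : E3) (s : ℝ), f (y, s) = a + Matrix.toEuclideanLin A y + s • b}

/-- The Bayes estimator `g⋆(Z) = 𝔼[X | Z]`, the conditional expectation of `X` given the
σ-algebra generated by `Z`, as a random variable. -/
def bayesEstimator {Ω : Type*} [MeasurableSpace Ω] (μ : Measure Ω) (X : Ω → E3)
    (Z : Ω → E3 × ℝ) : Ω → E3 :=
  μ[X | MeasurableSpace.comap Z inferInstance]

/-- The mean squared error `𝔼 ‖X - X'‖²`, as an extended nonnegative real. -/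
def mse {Ω : Type*} [MeasurableSpace Ω] (μ : Measure Ω) (X X' : Ω → E3) : ENNReal :=
  ∫⁻ ω, ‖X ω - X' ω‖ₑ ^ 2 ∂μ

end Doppler

end

namespace Doppler

open scoped ENNReal

/-! Write `X = u(P)ᵀV`, `R = ‖P‖`, `c = ρ / σP ^ 2`. Flipping the signs of `P`, `V`, `N` together
preserves the joint law; it fixes `S` and negates `Y`. Suppose `𝔼[P | Z] = a + AY + bS`. Testing
against `Y j`, and then against `Y i * S`, kills the `a` and `b` terms by parity. The first test
forces `A` to be a scalar matrix, and the second then gives `𝔼[Pᵢ² X] = σP ^ 2 * 𝔼[X]`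
(`integral_sq_mul_eq_of_bayesEstimator_affine`). Summing over `i` yields `𝔼[R² X] = 𝔼[R²] 𝔼[X]`.

On the other hand `V = cP + W` with `W` centred and independent of `P`, so `𝔼[Rⁿ X] = c 𝔼[Rⁿ⁺¹]`
(`integral_norm_pow_mul_radialVelocity`). As `c ≠ 0`, this leaves `𝔼[R³] = 𝔼[R²] 𝔼[R]`, which the
strict Chebyshev inequality forbids because `R` is not a.s. constant.

The strict gap in risk is Hilbert space geometry: the affine estimators form a finite-dimensional,
hence closed, subspace of `L²`, so a projection outside it lies at positive distance
(`lintegral_sub_condExp_lt_iInf`). -/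

/-- A random variable with finite moments of every order. -/
def HasMoments {Ω : Type*} [MeasurableSpace Ω] (f : Ω → ℝ) (μ : Measure Ω) : Prop :=
  ∀ p : ℝ≥0∞, p ≠ ∞ → MemLp f p μ

namespace HasMoments

variable {Ω : Type*} [MeasurableSpace Ω] {μ : Measure Ω} {f g : Ω → ℝ}

lemma integrable (hf : HasMoments f μ) : Integrable f μ :=
  memLp_one_iff_integrable.1 (hf 1 (by simp))

lemma memLp_two (hf : HasMoments f μ) : MemLp f 2 μ := hf 2 (by simp)

lemma add (hf : HasMoments f μ) (hg : HasMoments g μ) :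
    HasMoments (fun ω => f ω + g ω) μ := fun p hp => (hf p hp).add (hg p hp)

lemma sub (hf : HasMoments f μ) (hg : HasMoments g μ) :
    HasMoments (fun ω => f ω - g ω) μ := fun p hp => (hf p hp).sub (hg p hp)

lemma mul (hf : HasMoments f μ) (hg : HasMoments g μ) :
    HasMoments (fun ω => f ω * g ω) μ := fun p hp => by
  -- Hölder with `1/p = 1/(2p) + 1/(2p)`.
  have h2 : 2 * p ≠ ∞ := ENNReal.mul_ne_top (by simp) hp
  have : ENNReal.HolderTriple (2 * p) (2 * p) p := ⟨by
    rw [ENNReal.mul_inv (by simp) (by simp), ← add_mul, ENNReal.inv_two_add_inv_two, one_mul]⟩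
  exact (hg _ h2).mul (hf _ h2)

lemma const [IsFiniteMeasure μ] (c : ℝ) : HasMoments (fun _ => c) μ := fun _ _ => memLp_const c

lemma pow [IsFiniteMeasure μ] (hf : HasMoments f μ) (n : ℕ) :
    HasMoments (fun ω => f ω ^ n) μ := by
  induction n with
  | zero => simpa using const 1
  | succ n ih => simpa only [pow_succ] using ih.mul hf

lemma sum {ι : Type*} (s : Finset ι) {f : ι → Ω → ℝ} (hf : ∀ i, HasMoments (f i) μ) :
    HasMoments (fun ω => ∑ i ∈ s, f i ω) μ :=
  fun p hp => memLp_finsetSum s fun i _ => hf i p hp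

end HasMoments

/-! ### Symmetry and correlation inequalities -/

/-- A centred Gaussian random variable is symmetric. -/
lemma identDistrib_neg_of_hasGaussianLaw {Ω E : Type*} [MeasurableSpace Ω] {μ : Measure Ω}
    [NormedAddCommGroup E] [NormedSpace ℝ E] [CompleteSpace E] [SecondCountableTopology E]
    [MeasurableSpace E] [BorelSpace E] {X : Ω → E} (hX : HasGaussianLaw X μ)
    (hmean : ∫ ω, X ω ∂μ = 0) : IdentDistrib X (fun ω => -X ω) μ μ := by
  refine ⟨hX.aemeasurable, hX.aemeasurable.neg, ?_⟩
  have := hX.isProbabilityMeasure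
  have hX' := hX.fun_neg
  have := hX.isGaussian_map
  have := hX'.isGaussian_map
  refine Measure.ext_of_charFunDual ?_
  ext L
  -- The characteristic function depends only on the mean and variance of each `L X`; the mean is
  -- zero and the variance is even.
  have hL : ∫ ω, L (X ω) ∂μ = 0 := by
    rw [L.integral_comp_comm hX.integrable, hmean, map_zero]
  rw [hX.charFunDual_map_eq_fun, hX'.charFunDual_map_eq_fun]
  simp only [map_neg, integral_neg, hL, variance_fun_neg]
  simp

/-- Chebyshev's correlation inequality in its strict form, for the increasing pair `x`, `x ^ 2`. -/
lemma integral_sq_mul_integral_ne {Ω : Type*} [MeasurableSpace Ω] {μ : Measure Ω}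
    [IsProbabilityMeasure μ] {R : Ω → ℝ} (hR : HasMoments R μ) (hpos : ∀ ω, 0 ≤ R ω)
    (hnc : ∀ m, ¬ R =ᵐ[μ] fun _ => m) :
    ∫ ω, R ω ^ 3 ∂μ ≠ (∫ ω, R ω ^ 2 ∂μ) * ∫ ω, R ω ∂μ := by
  intro h
  set m := ∫ ω, R ω ∂μ with hm
  have hm0 : 0 ≤ m := integral_nonneg hpos
  -- This integral equals `𝔼[R³] - 𝔼[R²] 𝔼[R]`, and its integrand is nonnegative.
  have hI : ∫ ω, (R ω + m) * (R ω - m) ^ 2 ∂μ = 0 := by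
    have e : ∀ ω, (R ω + m) * (R ω - m) ^ 2 = R ω ^ 3 - R ω ^ 2 * m - (R ω * m ^ 2 - m ^ 3) :=
      fun ω => by ring
    simp_rw [e]
    rw [integral_sub, integral_sub, integral_sub, integral_mul_const, integral_mul_const, h,
      ← hm]
    · simp; ring
    · exact (hR.mul (.const _)).integrable
    · exact (HasMoments.const _).integrable
    · exact (hR.pow 3).integrable
    · exact ((hR.pow 2).mul (.const _)).integrable
    · exact ((hR.pow 3).sub ((hR.pow 2).mul (.const _))).integrable
    · exact ((hR.mul (.const _)).sub (.const _)).integrable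
  have hint : Integrable (fun ω => (R ω + m) * (R ω - m) ^ 2) μ :=
    ((hR.add (.const m)).mul ((hR.sub (.const m)).pow 2)).integrable
  rw [integral_eq_zero_iff_of_nonneg
    (fun ω => mul_nonneg (add_nonneg (hpos ω) hm0) (sq_nonneg _)) hint] at hI
  refine hnc m ?_
  filter_upwards [hI] with ω hω
  rcases mul_eq_zero.1 hω with h1 | h1
  -- Both summands are nonnegative, so `R ω = m = 0`.
  · linarith [hpos ω]
  · exact sub_eq_zero.1 (pow_eq_zero_iff (two_ne_zero) |>.1 h1)

/-! ### Conditional expectation as an `L²` projection -/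

/-- Moments of the conditional expectation against an observable test variable. -/
lemma integral_mul_condExp {Ω : Type*} {m m₀ : MeasurableSpace Ω} {μ : Measure Ω}
    [IsProbabilityMeasure μ] (hm : m ≤ m₀) {f φ : Ω → ℝ} (hf : Integrable f μ)
    (hφ : StronglyMeasurable[m] φ) (hφf : Integrable (fun ω => φ ω * f ω) μ) :
    ∫ ω, φ ω * (μ[f | m]) ω ∂μ = ∫ ω, φ ω * f ω ∂μ := by
  rw [← integral_condExp hm (f := fun ω => φ ω * f ω)]
  exact integral_congr_ae (condExp_mul_of_stronglyMeasurable_left hφ hφf hf).symm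

lemma lintegral_enorm_sub_sq_eq_ofReal {Ω E : Type*} [MeasurableSpace Ω] {μ : Measure Ω}
    [NormedAddCommGroup E] {X : Ω → E} {Y : Ω → E} {X' Y' : Lp E 2 μ}
    (hX : X' =ᵐ[μ] X) (hY : Y' =ᵐ[μ] Y) :
    ∫⁻ ω, ‖X ω - Y ω‖ₑ ^ 2 ∂μ = ENNReal.ofReal (‖X' - Y'‖ ^ 2) := by
  have h1 : ∫⁻ ω, ‖X ω - Y ω‖ₑ ^ 2 ∂μ = eLpNorm (X' - Y' : Lp E 2 μ) 2 μ ^ 2 := by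
    rw [eLpNorm_eq_lintegral_rpow_enorm_toReal (by simp) (by simp)]
    simp only [ENNReal.toReal_ofNat, ENNReal.rpow_ofNat]
    rw [← ENNReal.rpow_two, ← ENNReal.rpow_mul]
    simp only [one_div, ne_eq, OfNat.ofNat_ne_zero, not_false_eq_true, inv_mul_cancel₀,
      ENNReal.rpow_one]
    refine lintegral_congr_ae ?_
    filter_upwards [hX, hY, Lp.coeFn_sub X' Y'] with ω h1 h2 h3
    rw [h3, Pi.sub_apply, h1, h2]
  rw [h1, ENNReal.ofReal_pow (norm_nonneg _), Lp.norm_def, ENNReal.ofReal_toReal (Lp.eLpNorm_ne_top _)]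

/-- If the conditional expectation does not lie in a finite-dimensional space of observable
estimators, then it is better than the whole space by a positive margin. -/
theorem lintegral_sub_condExp_lt_iInf {Ω E W : Type*} {m m₀ : MeasurableSpace Ω} {μ : Measure Ω}
    [IsProbabilityMeasure μ] (hm : m ≤ m₀) [NormedAddCommGroup E] [InnerProductSpace ℝ E]
    [CompleteSpace E] [AddCommGroup W] [Module ℝ W] [FiniteDimensional ℝ W]
    {X : Ω → E} (hX : MemLp X 2 μ) (T : W →ₗ[ℝ] (Ω → E)) (hT : ∀ w, MemLp (T w) 2 μ)
    (hTm : ∀ w, AEStronglyMeasurable[m] (T w) μ) (hne : ¬ ∃ w, μ[X | m] =ᵐ[μ] T w) :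
    ∫⁻ ω, ‖X ω - (μ[X | m]) ω‖ₑ ^ 2 ∂μ < ⨅ w, ∫⁻ ω, ‖X ω - T w ω‖ₑ ^ 2 ∂μ := by
  let T' : W →ₗ[ℝ] Lp E 2 μ :=
    { toFun := fun w => (hT w).toLp
      map_add' := fun v w => by
        rw [← MemLp.toLp_add]; exact MemLp.toLp_congr _ _ (by simp)
      map_smul' := fun c w => by
        rw [RingHom.id_apply, ← MemLp.toLp_const_smul]
        exact MemLp.toLp_congr _ _ (by simp) }
  let G : Lp E 2 μ := condExpL2 E ℝ hm hX.toLp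
  have hG : G =ᵐ[μ] μ[X | m] := hX.condExpL2_ae_eq_condExp (𝕜 := ℝ) hm
  have hGm : AEStronglyMeasurable[m] G μ := aestronglyMeasurable_condExpL2 hm _
  have hG_notMem : G ∉ (LinearMap.range T' : Set (Lp E 2 μ)) := by
    rintro ⟨w, hw⟩
    refine hne ⟨w, hG.symm.trans ?_⟩
    rw [← hw]
    exact (hT w).coeFn_toLp
  have hclosed : IsClosed (LinearMap.range T' : Set (Lp E 2 μ)) :=
    Submodule.closed_of_finiteDimensional _
  have hd := (hclosed.notMem_iff_infDist_pos ⟨_, LinearMap.mem_range_self T' 0⟩).1 hG_notMem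
  set d := Metric.infDist G (LinearMap.range T' : Set (Lp E 2 μ))
  -- Pythagoras: `X - G` is orthogonal to every `m`-measurable element of `L²`, in particular to `G
  -- - T' w`.
  have hmain : ∀ w, ENNReal.ofReal (‖hX.toLp - G‖ ^ 2 + d ^ 2) ≤
      ∫⁻ ω, ‖X ω - T w ω‖ₑ ^ 2 ∂μ := by
    intro w
    rw [lintegral_enorm_sub_sq_eq_ofReal hX.coeFn_toLp (hT w).coeFn_toLp]
    refine ENNReal.ofReal_le_ofReal ?_
    have hsplit : hX.toLp - (hT w).toLp = (hX.toLp - G) + (G - T' w) := by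
      simp [T']
    have hinner : inner ℝ (hX.toLp - G) (G - T' w) = 0 := by
      rw [inner_sub_left, sub_eq_zero]
      refine (inner_condExpL2_eq_inner_fun hm _ _ ?_).symm
      have : AEStronglyMeasurable[m] (fun ω => G ω - T w ω) μ := hGm.sub (hTm w)
      refine this.congr ?_
      filter_upwards [Lp.coeFn_sub G (T' w), (hT w).coeFn_toLp] with ω h1 h2
      rw [h1, Pi.sub_apply, ← h2]; rfl
    rw [hsplit, norm_add_sq_real, hinner]
    have hdist : d ≤ ‖G - T' w‖ := by
      rw [← dist_eq_norm]
      exact Metric.infDist_le_dist_of_mem (LinearMap.mem_range_self T' w)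
    have := pow_le_pow_left₀ hd.le hdist 2
    linarith
  refine lt_of_lt_of_le ?_ (le_iInf hmain)
  rw [lintegral_enorm_sub_sq_eq_ofReal hX.coeFn_toLp hG]
  refine (ENNReal.ofReal_lt_ofReal_iff (by positivity)).2 ?_
  have := pow_pos hd 2
  linarith

/-! ### Moment identities forced by an affine Bayes estimator -/

/-- If the Bayes estimator is affine and the model is symmetric in the sign of position and noise,
then the third moments `𝔼[Pᵢ² X]` factor as in the jointly Gaussian case. -/
theorem integral_sq_mul_eq_of_bayesEstimator_affine {Ω : Type*} [MeasurableSpace Ω] {μ : Measure Ω}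
    [IsProbabilityMeasure μ] {P N : Ω → E3} {X ε : Ω → ℝ} {s t : ℝ}
    (hP : Measurable P) (hN : Measurable N) (hX : Measurable X) (hε : Measurable ε)
    (hPm : ∀ i, HasMoments (fun ω => P ω i) μ) (hNm : ∀ i, HasMoments (fun ω => N ω i) μ)
    (hXm : HasMoments X μ) (hεm : HasMoments ε μ)
    (hind : IndepFun (fun ω => (P ω, X ω)) (fun ω => (N ω, ε ω)) μ)
    (hNε : IndepFun N ε μ)
    (hsym : IdentDistrib (fun ω => ((P ω, X ω), (N ω, ε ω)))
      (fun ω => ((-P ω, X ω), (-N ω, ε ω))) μ μ)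
    (hε0 : ∫ ω, ε ω ∂μ = 0)
    (hP2 : ∀ i j, ∫ ω, P ω i * P ω j ∂μ = if i = j then s else 0)
    (hN2 : ∀ i j, ∫ ω, N ω i * N ω j ∂μ = if i = j then t else 0)
    (ht : t ≠ 0) (a b : E3) (A : Matrix (Fin 3) (Fin 3) ℝ)
    (h : bayesEstimator μ P (fun ω => (P ω + N ω, X ω + ε ω)) =ᵐ[μ]
      fun ω => a + Matrix.toEuclideanLin A (P ω + N ω) + (X ω + ε ω) • b) (i : Fin 3) :
    ∫ ω, P ω i ^ 2 * X ω ∂μ = s * ∫ ω, X ω ∂μ := by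
  have hodd : ∀ F : (E3 × ℝ) × (E3 × ℝ) → ℝ, Measurable F →
      (∀ p x n e, F ((-p, x), (-n, e)) = -F ((p, x), (n, e))) →
      ∫ ω, F ((P ω, X ω), (N ω, ε ω)) ∂μ = 0 := by
    intro F hF hFo
    have h1 := (hsym.comp hF).integral_eq
    simp only [Function.comp_def, hFo, integral_neg] at h1
    linarith
  have hprod : ∀ f g : E3 × ℝ → ℝ, Measurable f → Measurable g →
      ∫ ω, f (P ω, X ω) * g (N ω, ε ω) ∂μ =
        (∫ ω, f (P ω, X ω) ∂μ) * ∫ ω, g (N ω, ε ω) ∂μ := fun f g hf hg =>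
    hind.integral_fun_comp_mul_comp (by fun_prop) (by fun_prop) hf.aestronglyMeasurable
      hg.aestronglyMeasurable
  have hYm : ∀ k, HasMoments (fun ω => P ω k + N ω k) μ := fun k => (hPm k).add (hNm k)
  have hSm : HasMoments (fun ω => X ω + ε ω) μ := hXm.add hεm
  have hPN : ∀ j k, ∫ ω, P ω j * N ω k ∂μ = 0 := by
    intro j k
    have h1 := hprod (fun q => q.1 j) (fun q => q.1 k) (by fun_prop) (by fun_prop)
    have h2 := hodd (fun q => q.1.1 j) (by fun_prop) (by simp)
    simp only at h1 h2
    rw [h1, h2, zero_mul]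
  have hYY : ∀ j k, ∫ ω, (P ω j + N ω j) * (P ω k + N ω k) ∂μ = if j = k then s + t else 0 := by
    intro j k
    have e : ∀ ω, (P ω j + N ω j) * (P ω k + N ω k) =
      (P ω j * P ω k + N ω j * N ω k) + (P ω j * N ω k + P ω k * N ω j) := fun ω => by ring
    simp_rw [e]
    rw [integral_add, integral_add, integral_add, hP2, hN2, hPN, hPN]
    · split_ifs <;> simp
    all_goals first
      | exact ((hPm _).mul (hNm _)).integrable
      | exact ((hPm _).mul (hPm _)).integrable
      | exact ((hNm _).mul (hNm _)).integrable
      | exact (((hPm _).mul (hPm _)).add ((hNm _).mul (hNm _))).integrable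
      | exact (((hPm _).mul (hNm _)).add ((hPm _).mul (hNm _))).integrable
  have hYP : ∀ j, ∫ ω, (P ω j + N ω j) * P ω i ∂μ = if i = j then s else 0 := by
    intro j
    have e : ∀ ω, (P ω j + N ω j) * P ω i = P ω i * P ω j + P ω i * N ω j := fun ω => by ring
    simp_rw [e]
    rw [integral_add ((hPm _).mul (hPm _)).integrable ((hPm _).mul (hNm _)).integrable,
      hP2, hPN, add_zero]
  have htest : ∀ φ : E3 × ℝ → ℝ, Measurable φ →
      HasMoments (fun ω => φ (P ω + N ω, X ω + ε ω)) μ →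
      ∫ ω, φ (P ω + N ω, X ω + ε ω) * P ω i ∂μ =
        (∫ ω, φ (P ω + N ω, X ω + ε ω) ∂μ) * a i +
        (∑ k, (∫ ω, φ (P ω + N ω, X ω + ε ω) * (P ω k + N ω k) ∂μ) * A i k) +
        (∫ ω, φ (P ω + N ω, X ω + ε ω) * (X ω + ε ω) ∂μ) * b i := by
    intro φ hφ hφm
    set Z : Ω → E3 × ℝ := fun ω => (P ω + N ω, X ω + ε ω) with hZ
    have hZm : Measurable Z := by fun_prop
    have hPint : Integrable P μ := .of_eval_piLp fun k => (hPm k).integrable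
    have hcomp := (EuclideanSpace.proj (𝕜 := ℝ) i).comp_condExp_comm
      (m := MeasurableSpace.comap Z inferInstance) hPint
    have htower : ∫ ω, φ (P ω + N ω, X ω + ε ω) * P ω i ∂μ = ∫ ω, φ (Z ω) *
        (μ[fun ω => P ω i | MeasurableSpace.comap Z inferInstance]) ω ∂μ :=
      (integral_mul_condExp hZm.comap_le (hPm i).integrable
        (hφ.comp (comap_measurable Z)).stronglyMeasurable (hφm.mul (hPm i)).integrable).symm
    have hg : ∀ᵐ ω ∂μ, φ (Z ω) * (μ[fun ω => P ω i | MeasurableSpace.comap Z inferInstance]) ω =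
        φ (Z ω) * a i + (∑ k, φ (Z ω) * (P ω k + N ω k) * A i k) +
          φ (Z ω) * (X ω + ε ω) * b i := by
      filter_upwards [hcomp, h] with ω h1 h2
      have h3 : (μ[fun ω => P ω i | MeasurableSpace.comap Z inferInstance]) ω =
          a i + (∑ k, A i k * (P ω k + N ω k)) + (X ω + ε ω) * b i := by
        refine Eq.trans h1.symm ?_
        have h4 := congrArg (fun v : E3 => v i) h2
        simpa [bayesEstimator, Matrix.toLpLin_apply, Matrix.mulVec, dotProduct] using h4
      rw [h3, mul_add, mul_add, Finset.mul_sum]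
      congr 1
      · congr 1
        exact Finset.sum_congr rfl fun k _ => by ring
      · ring
    have hk : ∀ k, HasMoments (fun ω => φ (Z ω) * (P ω k + N ω k) * A i k) μ :=
      fun k => (hφm.mul (hYm k)).mul (.const _)
    have ha : HasMoments (fun ω => φ (Z ω) * a i) μ := hφm.mul (.const _)
    rw [htower, integral_congr_ae hg, integral_add (ha.add (.sum _ hk)).integrable
      ((hφm.mul hSm).mul (.const _)).integrable, integral_add ha.integrable
      (HasMoments.sum _ hk).integrable, integral_finsetSum _ fun k _ => (hk k).integrable]
    simp only [integral_mul_const]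
    rfl
  -- Test against `Y j`: both `𝔼[Y j]` and `𝔼[Y j * S]` vanish by parity.
  have hA : ∀ j, (if i = j then s else 0) = (s + t) * A i j := by
    intro j
    have h1 := htest (fun q => q.1 j) (by fun_prop) (hYm j)
    have h2 := hodd (fun q => q.1.1 j + q.2.1 j) (by fun_prop) (fun p x n e => by simp; ring)
    have h3 := hodd (fun q => (q.1.1 j + q.2.1 j) * (q.1.2 + q.2.2)) (by fun_prop)
      (fun p x n e => by simp; ring)
    simp only [PiLp.add_apply] at h1 h2 h3
    rw [hYP, h2, h3] at h1
    simp only [hYY] at h1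
    simpa using h1
  have hs0 : 0 ≤ s := by
    have h1 := hP2 i i
    rw [if_pos rfl] at h1
    exact h1 ▸ integral_nonneg fun ω => mul_self_nonneg _
  have ht0 : 0 < t := by
    have h1 := hN2 i i
    rw [if_pos rfl] at h1
    exact lt_of_le_of_ne (h1 ▸ integral_nonneg fun ω => mul_self_nonneg _) ht.symm
  have hst : s + t ≠ 0 := by linarith
  -- Test against `Y i * S`: parity again removes `a` and `b`, and `hA` removes the off-diagonal
  -- entries of `A`.
  have hkey : ∫ ω, (P ω i + N ω i) * (X ω + ε ω) * P ω i ∂μ =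
      (∫ ω, (P ω i + N ω i) * (X ω + ε ω) * (P ω i + N ω i) ∂μ) * A i i := by
    have h1 := htest (fun q => q.1 i * q.2) (by fun_prop) ((hYm i).mul hSm)
    have h2 := hodd (fun q => (q.1.1 i + q.2.1 i) * (q.1.2 + q.2.2)) (by fun_prop)
      (fun p x n e => by simp; ring)
    have h3 := hodd (fun q => (q.1.1 i + q.2.1 i) * (q.1.2 + q.2.2) * (q.1.2 + q.2.2))
      (by fun_prop) (fun p x n e => by simp; ring)
    simp only [PiLp.add_apply] at h1 h2 h3
    rw [h1, h2, h3, Finset.sum_eq_single i]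
    · ring
    · intro k _ hki
      have h4 := hA k
      rw [if_neg hki.symm] at h4
      rw [(mul_eq_zero.1 h4.symm).resolve_left hst, mul_zero]
    · simp
  have hPPX : HasMoments (fun ω => P ω i ^ 2 * X ω) μ := ((hPm i).pow 2).mul hXm
  have hNNX : HasMoments (fun ω => X ω * (N ω i * N ω i)) μ := hXm.mul ((hNm i).mul (hNm i))
  have hPPε : HasMoments (fun ω => P ω i ^ 2 * ε ω) μ := ((hPm i).pow 2).mul hεm
  have hPXN : HasMoments (fun ω => P ω i * X ω * N ω i) μ := ((hPm i).mul hXm).mul (hNm i)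
  have hPNε : HasMoments (fun ω => P ω i * (N ω i * ε ω)) μ := (hPm i).mul ((hNm i).mul hεm)
  have hNNε : HasMoments (fun ω => N ω i ^ 2 * ε ω) μ := ((hNm i).pow 2).mul hεm
  have iPPε : ∫ ω, P ω i ^ 2 * ε ω ∂μ = 0 := by
    rw [hprod (fun q => q.1 i ^ 2) (fun q => q.2) (by fun_prop) (by fun_prop), hε0, mul_zero]
  have iPXN : ∫ ω, P ω i * X ω * N ω i ∂μ = 0 := by
    have h1 := hodd (fun q => q.2.1 i) (by fun_prop) (by simp)
    rw [hprod (fun q => q.1 i * q.2) (fun q => q.1 i) (by fun_prop) (by fun_prop), h1, mul_zero]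
  have iPNε : ∫ ω, P ω i * (N ω i * ε ω) ∂μ = 0 := by
    have h1 := hodd (fun q => q.1.1 i) (by fun_prop) (by simp)
    rw [hprod (fun q => q.1 i) (fun q => q.1 i * q.2) (by fun_prop) (by fun_prop), h1, zero_mul]
  have iNNε : ∫ ω, N ω i ^ 2 * ε ω ∂μ = 0 := by
    rw [hNε.integral_fun_comp_mul_comp (f := fun n => n i ^ 2) (g := fun e => e) (by fun_prop)
      (by fun_prop) (by fun_prop) (by fun_prop), hε0, mul_zero]
  have iXNN : ∫ ω, X ω * (N ω i * N ω i) ∂μ = (∫ ω, X ω ∂μ) * t := by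
    rw [hprod (fun q => q.2) (fun q => q.1 i * q.1 i) (by fun_prop) (by fun_prop), hN2,
      if_pos rfl]
  have hleft : ∫ ω, (P ω i + N ω i) * (X ω + ε ω) * P ω i ∂μ = ∫ ω, P ω i ^ 2 * X ω ∂μ := by
    have e : ∀ ω, (P ω i + N ω i) * (X ω + ε ω) * P ω i = P ω i ^ 2 * X ω +
        (P ω i ^ 2 * ε ω + (P ω i * X ω * N ω i + P ω i * (N ω i * ε ω))) := fun ω => by ring
    simp_rw [e]
    rw [integral_add hPPX.integrable (hPPε.add (hPXN.add hPNε)).integrable,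
      integral_add hPPε.integrable (hPXN.add hPNε).integrable,
      integral_add hPXN.integrable hPNε.integrable, iPPε, iPXN, iPNε]
    ring
  have hright : ∫ ω, (P ω i + N ω i) * (X ω + ε ω) * (P ω i + N ω i) ∂μ =
      ∫ ω, P ω i ^ 2 * X ω ∂μ + (∫ ω, X ω ∂μ) * t := by
    have e : ∀ ω, (P ω i + N ω i) * (X ω + ε ω) * (P ω i + N ω i) =
        (P ω i + N ω i) * (X ω + ε ω) * P ω i + (X ω * (N ω i * N ω i) +
        (P ω i * X ω * N ω i + (P ω i * (N ω i * ε ω) + N ω i ^ 2 * ε ω))) := fun ω => by ring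
    simp_rw [e]
    rw [integral_add (((hYm i).mul hSm).mul (hPm i)).integrable
        (hNNX.add (hPXN.add (hPNε.add hNNε))).integrable,
      integral_add hNNX.integrable (hPXN.add (hPNε.add hNNε)).integrable,
      integral_add hPXN.integrable (hPNε.add hNNε).integrable,
      integral_add hPNε.integrable hNNε.integrable, hleft, iXNN, iPXN, iPNε, iNNε]
    ring
  have hAi := hA i
  rw [if_pos rfl] at hAi
  rw [hleft, hright] at hkey
  -- Eliminating `A i i` leaves the desired identity multiplied by `t`; this is where the noise in
  -- `Y` must be nondegenerate.
  refine mul_left_cancel₀ ht ?_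
  linear_combination (s + t) * hkey - (∫ ω, P ω i ^ 2 * X ω ∂μ + (∫ ω, X ω ∂μ) * t) * hAi

/-! ### Gaussian moments and the radial velocity -/

lemma integral_mul_of_covMatrix {Ω : Type*} [MeasurableSpace Ω] {μ : Measure Ω}
    [IsProbabilityMeasure μ] {X Y : Ω → E3} {s : ℝ} (hX : ∀ i, HasMoments (fun ω => X ω i) μ)
    (hY : ∀ i, HasMoments (fun ω => Y ω i) μ) (hX0 : ∀ i, ∫ ω, X ω i ∂μ = 0)
    (h : covMatrix μ X Y = s • (1 : Matrix (Fin 3) (Fin 3) ℝ)) (i j : Fin 3) :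
    ∫ ω, X ω i * Y ω j ∂μ = if i = j then s else 0 := by
  have h1 := congrFun (congrFun h i) j
  simp only [covMatrix, Matrix.of_apply, Matrix.smul_apply, Matrix.one_apply] at h1
  rw [covariance_eq_sub (hX i).memLp_two (hY j).memLp_two, hX0] at h1
  simpa using h1

lemma integral_apply_eq_zero {Ω : Type*} [MeasurableSpace Ω] {μ : Measure Ω} {X : Ω → E3}
    (hX : Integrable X μ) (h : ∫ ω, X ω ∂μ = 0) (i : Fin 3) : ∫ ω, X ω i ∂μ = 0 := by
  have := (EuclideanSpace.proj (𝕜 := ℝ) i).integral_comp_comm hX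
  simpa [h] using this

lemma hasMoments_apply {Ω : Type*} [MeasurableSpace Ω] {μ : Measure Ω} {X : Ω → E3}
    (hX : HasGaussianLaw X μ) (i : Fin 3) : HasMoments (fun ω => X ω i) μ :=
  fun _ hp => (hX.map_fun (EuclideanSpace.proj (𝕜 := ℝ) i)).memLp hp

lemma hasMoments_norm {Ω : Type*} [MeasurableSpace Ω] {μ : Measure Ω} {X : Ω → E3}
    (hX : HasGaussianLaw X μ) : HasMoments (fun ω => ‖X ω‖) μ :=
  fun _ hp => (hX.memLp hp).norm

lemma measurable_lineOfSight : Measurable lineOfSight := by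
  unfold lineOfSight; fun_prop

lemma norm_lineOfSight_le (p : E3) : ‖lineOfSight p‖ ≤ 1 := by
  rw [lineOfSight, norm_smul, norm_inv, norm_norm]
  exact inv_mul_le_one

lemma inner_lineOfSight_self (p : E3) : inner ℝ (lineOfSight p) p = ‖p‖ := by
  rw [lineOfSight, real_inner_smul_left, real_inner_self_eq_norm_sq]
  -- At the origin `lineOfSight` is `0`, so no null set has to be removed.
  rcases eq_or_ne ‖p‖ 0 with h | h
  · simp [h]
  · field_simp

lemma lineOfSight_neg (p : E3) : lineOfSight (-p) = -lineOfSight p := by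
  simp [lineOfSight]

lemma hasMoments_lineOfSight_apply {Ω : Type*} [MeasurableSpace Ω] {μ : Measure Ω}
    [IsProbabilityMeasure μ] {P : Ω → E3} (hP : Measurable P) (i : Fin 3) :
    HasMoments (fun ω => lineOfSight (P ω) i) μ := fun p _ => by
  refine MemLp.of_bound ?_ 1 (.of_forall fun ω => (PiLp.norm_apply_le _ i).trans
    (norm_lineOfSight_le _))
  have := measurable_lineOfSight.comp hP
  exact Measurable.aestronglyMeasurable (by fun_prop)

lemma hasMoments_radialVelocity {Ω : Type*} [MeasurableSpace Ω] {μ : Measure Ω}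
    [IsProbabilityMeasure μ] {P V : Ω → E3} (hP : Measurable P)
    (hV : ∀ i, HasMoments (fun ω => V ω i) μ) :
    HasMoments (fun ω => inner ℝ (lineOfSight (P ω)) (V ω)) μ := by
  simp only [PiLp.inner_apply, RCLike.inner_apply, conj_trivial]
  exact .sum _ fun i => (hV i).mul (hasMoments_lineOfSight_apply hP i)

/-- The regression residual `V - c P` is independent of `P`. -/
lemma indepFun_residual {Ω : Type*} [MeasurableSpace Ω] {μ : Measure Ω} [IsProbabilityMeasure μ]
    {P V : Ω → E3} {s ρ c : ℝ} (hPV : HasGaussianLaw (fun ω => (P ω, V ω)) μ)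
    (hPcov : covMatrix μ P P = s • (1 : Matrix (Fin 3) (Fin 3) ℝ))
    (hVPcov : covMatrix μ V P = ρ • (1 : Matrix (Fin 3) (Fin 3) ℝ)) (hc : ρ = c * s) :
    IndepFun P (fun ω => V ω - c • P ω) μ := by
  have hPm := hasMoments_apply hPV.fst
  have hVm := hasMoments_apply hPV.snd
  have hG : HasGaussianLaw (fun ω => ((fun i => P ω i), fun j => V ω j - c * P ω j)) μ := by
    let A : E3 →L[ℝ] (Fin 3 → ℝ) := .pi fun i => EuclideanSpace.proj i
    exact hPV.map_fun ((A ∘L .fst ℝ E3 E3).prod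
      (A ∘L (.snd ℝ E3 E3 - c • .fst ℝ E3 E3)))
  -- For jointly Gaussian coordinates zero covariance suffices, and `Cov(P i, V j - c * P j)` is `ρ
  -- - c * s = 0` or `0`.
  have hI := hG.indepFun_of_covariance_eval (X := fun i ω => P ω i)
    (Y := fun j ω => V ω j - c * P ω j) fun i j => by
      have h1 := congrFun (congrFun hPcov i) j
      have h2 := congrFun (congrFun hVPcov j) i
      simp only [covMatrix, Matrix.of_apply, Matrix.smul_apply, Matrix.one_apply] at h1 h2
      rw [covariance_comm] at h2
      rw [covariance_fun_sub_right (hPm i).memLp_two (hVm j).memLp_two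
        ((hPm j).memLp_two.const_mul c), covariance_const_mul_right, h1, h2, hc]
      by_cases hij : i = j
      · simp [hij]
      · simp [hij, Ne.symm hij]
  have := hI.comp (WithLp.measurable_toLp 2 (Fin 3 → ℝ)) (WithLp.measurable_toLp 2 (Fin 3 → ℝ))
  exact this

/-- Radial moments of the Doppler observable. -/
lemma integral_norm_pow_mul_radialVelocity {Ω : Type*} [MeasurableSpace Ω] {μ : Measure Ω}
    [IsProbabilityMeasure μ] {P V : Ω → E3} {c : ℝ} (hP : Measurable P) (hV : Measurable V)
    (hPV : HasGaussianLaw (fun ω => (P ω, V ω)) μ)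
    (hP0 : ∀ i, ∫ ω, P ω i ∂μ = 0) (hV0 : ∀ i, ∫ ω, V ω i ∂μ = 0)
    (hind : IndepFun P (fun ω => V ω - c • P ω) μ) (n : ℕ) :
    ∫ ω, ‖P ω‖ ^ n * inner ℝ (lineOfSight (P ω)) (V ω) ∂μ = c * ∫ ω, ‖P ω‖ ^ (n + 1) ∂μ := by
  have hPm := hasMoments_apply hPV.fst
  have hVm := hasMoments_apply hPV.snd
  have hR := hasMoments_norm hPV.fst
  have hWm : ∀ i, HasMoments (fun ω => V ω i - c * P ω i) μ :=
    fun i => (hVm i).sub ((HasMoments.const c).mul (hPm i))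
  have hW0 : ∀ i, ∫ ω, V ω i - c * P ω i ∂μ = 0 := fun i => by
    rw [integral_sub (hVm i).integrable ((hPm i).integrable.const_mul c), integral_const_mul,
      hP0, hV0]
    simp
  -- Split `V = cP + W`; the `cP` part gives `c‖P‖`, and each `W` term factors by independence into
  -- a product with mean zero.
  have e : ∀ ω, ‖P ω‖ ^ n * inner ℝ (lineOfSight (P ω)) (V ω) = c * ‖P ω‖ ^ (n + 1) +
      ∑ i, (‖P ω‖ ^ n * lineOfSight (P ω) i) * (V ω i - c * P ω i) := by
    intro ω
    have h1 : V ω = c • P ω + (V ω - c • P ω) := by abel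
    conv_lhs => rw [h1, inner_add_right, real_inner_smul_right, inner_lineOfSight_self]
    simp only [PiLp.inner_apply, RCLike.inner_apply, conj_trivial, PiLp.sub_apply,
      PiLp.smul_apply, smul_eq_mul, mul_add, Finset.mul_sum]
    congr 1
    · ring
    · exact Finset.sum_congr rfl fun i _ => by ring
  have hterm : ∀ i, HasMoments
      (fun ω => (‖P ω‖ ^ n * lineOfSight (P ω) i) * (V ω i - c * P ω i)) μ :=
    fun i => ((hR.pow n).mul (hasMoments_lineOfSight_apply hP i)).mul (hWm i)
  simp_rw [e]
  rw [integral_add ((hR.pow _).integrable.const_mul c) (HasMoments.sum _ hterm).integrable,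
    integral_const_mul, integral_finsetSum _ fun i _ => (hterm i).integrable,
    Finset.sum_eq_zero, add_zero]
  intro i _
  have hu := measurable_lineOfSight
  have h1 := hind.integral_fun_comp_mul_comp (f := fun p => ‖p‖ ^ n * lineOfSight p i)
    (g := fun w => w i) (by fun_prop) (by fun_prop)
    (Measurable.aestronglyMeasurable (by fun_prop)) (by fun_prop)
  simp only [PiLp.sub_apply, PiLp.smul_apply, smul_eq_mul] at h1
  rw [h1, hW0, mul_zero]

/-- The norm of a nondegenerate Gaussian vector is not almost surely constant. -/
lemma not_norm_ae_eq_const {Ω : Type*} [MeasurableSpace Ω] {μ : Measure Ω}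
    [IsProbabilityMeasure μ] {P : Ω → E3} (hP : HasGaussianLaw P μ) (i : Fin 3)
    (hvar : Var[fun ω => P ω i; μ] ≠ 0) (m : ℝ) : ¬ (fun ω => ‖P ω‖) =ᵐ[μ] fun _ => m := by
  intro h
  have hG : HasGaussianLaw (fun ω => P ω i) μ := hP.map_fun (EuclideanSpace.proj (𝕜 := ℝ) i)
  have hlaw := hG.map_eq_gaussianReal
  -- A constant norm `m` would bound `P i` by `m`, but a nondegenerate Gaussian charges every
  -- half-line.
  have h0 : (μ.map fun ω => P ω i) (Set.Ioi m) = 0 := by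
    rw [Measure.map_apply_of_aemeasurable hG.aemeasurable measurableSet_Ioi]
    refine measure_mono_null (fun ω hω => ?_) (ae_iff.1 h)
    have h1 : P ω i ≤ ‖P ω‖ := (le_abs_self _).trans (PiLp.norm_apply_le (P ω) i)
    exact (lt_of_lt_of_le hω h1).ne'
  rw [hlaw] at h0
  have hv : Var[fun ω => P ω i; μ].toNNReal ≠ 0 := by
    rw [ne_eq, Real.toNNReal_eq_zero, not_le]
    exact lt_of_le_of_ne (variance_nonneg _ _) hvar.symm
  have := gaussianReal_absolutelyContinuous' _ hv h0
  simp at this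

lemma covMatrix_of_hasLaw_multivariateGaussian {Ω : Type*} [MeasurableSpace Ω] {μ : Measure Ω}
    {N : Ω → E3} {S : Matrix (Fin 3) (Fin 3) ℝ} (hS : S.PosSemidef)
    (hN : HasLaw N (multivariateGaussian 0 S) μ) : covMatrix μ N N = S := by
  ext i j
  rw [← covariance_eval_multivariateGaussian (μ := 0) hS i j, ← hN.map_eq,
    covariance_map_fun (by fun_prop) (by fun_prop) hN.aemeasurable]
  rfl

/-! ### Affine estimators as a finite-dimensional family -/

/-- The affine estimators of the observation, parametrised linearly. -/
noncomputable def affineFamily {Ω : Type*} (Z : Ω → E3 × ℝ) :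
    E3 × E3 × Matrix (Fin 3) (Fin 3) ℝ →ₗ[ℝ] Ω → E3 where
  toFun w ω := w.1 + Matrix.toEuclideanLin w.2.2 (Z ω).1 + (Z ω).2 • w.2.1
  map_add' v w := by
    ext1 ω
    simp only [Prod.fst_add, Prod.snd_add, map_add, LinearMap.add_apply, smul_add, Pi.add_apply]
    abel
  map_smul' c w := by
    ext1 ω
    simp only [Prod.smul_fst, Prod.smul_snd, map_smul, LinearMap.smul_apply, smul_add,
      Pi.smul_apply, RingHom.id_apply, smul_comm c]

lemma measurable_affine (w : E3 × E3 × Matrix (Fin 3) (Fin 3) ℝ) :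
    Measurable fun z : E3 × ℝ => w.1 + Matrix.toEuclideanLin w.2.2 z.1 + z.2 • w.2.1 := by
  have h : Measurable fun y : E3 => Matrix.toEuclideanLin w.2.2 y :=
    (LinearMap.continuous_of_finiteDimensional _).measurable
  fun_prop

lemma exists_affineFamily_eq {Ω : Type*} (Z : Ω → E3 × ℝ) {f : E3 × ℝ → E3}
    (hf : f ∈ affineEstimators) : ∃ w, (fun ω => f (Z ω)) = affineFamily Z w := by
  obtain ⟨a, b, A, h⟩ := hf
  exact ⟨(a, b, A), funext fun ω => h (Z ω).1 (Z ω).2⟩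

lemma memLp_two_affineFamily {Ω : Type*} [MeasurableSpace Ω] {μ : Measure Ω}
    [IsProbabilityMeasure μ] {Z : Ω → E3 × ℝ} (hZ1 : MemLp (fun ω => (Z ω).1) 2 μ)
    (hZ2 : MemLp (fun ω => (Z ω).2) 2 μ) (w : E3 × E3 × Matrix (Fin 3) (Fin 3) ℝ) :
    MemLp (affineFamily Z w) 2 μ := by
  have h1 := (Matrix.toEuclideanLin w.2.2).toContinuousLinearMap.comp_memLp' hZ1
  have h2 := (ContinuousLinearMap.toSpanSingleton ℝ w.2.1).comp_memLp' hZ2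
  exact ((memLp_const w.1).add h1).add h2

end Doppler

/-! ### The main theorem -/

theorem corollary1 {Ω : Type*} [MeasurableSpace Ω] (μ : Measure Ω) [IsProbabilityMeasure μ]
    (P V N : Ω → Doppler.E3) (ε : Ω → ℝ) (σP σV σN σε ρ : ℝ)
    (hP : Measurable P) (hV : Measurable V) (hN : Measurable N) (hε : Measurable ε)
    (hσN : 0 < σN) (hρ : ρ ≠ 0)
    -- the prior: `P`, `V` jointly Gaussian, centred, isotropic and correlated
    (hPV : HasGaussianLaw (fun ω => (P ω, V ω)) μ)
    (hPmean : ∫ ω, P ω ∂μ = 0) (hVmean : ∫ ω, V ω ∂μ = 0)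
    (hPcov : Doppler.covMatrix μ P P = σP ^ 2 • (1 : Matrix (Fin 3) (Fin 3) ℝ))
    (hVcov : Doppler.covMatrix μ V V = σV ^ 2 • (1 : Matrix (Fin 3) (Fin 3) ℝ))
    (hVPcov : Doppler.covMatrix μ V P = ρ • (1 : Matrix (Fin 3) (Fin 3) ℝ))
    -- the noises: Gaussian, independent of each other and of `(P, V)`
    (hNlaw : HasLaw N (multivariateGaussian 0 (σN ^ 2 • (1 : Matrix (Fin 3) (Fin 3) ℝ))) μ)
    (hεlaw : HasLaw ε (gaussianReal 0 ⟨σε ^ 2, sq_nonneg σε⟩) μ)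
    (hNε : IndepFun N ε μ)
    (hindep : IndepFun (fun ω => (P ω, V ω)) (fun ω => (N ω, ε ω)) μ) :
    (¬ ∃ f ∈ Doppler.affineEstimators,
      Doppler.bayesEstimator μ P (Doppler.observation P V N ε)
        =ᵐ[μ] fun ω => f (Doppler.observation P V N ε ω)) ∧
    Doppler.mse μ P (Doppler.bayesEstimator μ P (Doppler.observation P V N ε)) <
      ⨅ f ∈ Doppler.affineEstimators,
        Doppler.mse μ P (fun ω => f (Doppler.observation P V N ε ω)) := by
  open Doppler in
  have hNG := hNlaw.hasGaussianLaw
  obtain ⟨v, hεlaw'⟩ : ∃ v : NNReal, HasLaw ε (gaussianReal 0 v) μ := ⟨_, hεlaw⟩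
  have hεG := hεlaw'.hasGaussianLaw
  have hu := measurable_lineOfSight
  have hPm := hasMoments_apply hPV.fst
  have hVm := hasMoments_apply hPV.snd
  have hNm := hasMoments_apply hNG
  have hεm : HasMoments ε μ := fun _ hp => hεG.memLp hp
  have hXm := hasMoments_radialVelocity hP hVm
  have hNmean : ∫ ω, N ω ∂μ = 0 := by
    rw [hNlaw.integral_eq, integral_id_multivariateGaussian]
  have hεmean : ∫ ω, ε ω ∂μ = 0 := by
    rw [hεlaw'.integral_eq, integral_id_gaussianReal]
  have hP0 := integral_apply_eq_zero hPV.fst.integrable hPmean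
  have hV0 := integral_apply_eq_zero hPV.snd.integrable hVmean
  have hN0 := integral_apply_eq_zero hNG.integrable hNmean
  have hNcov := covMatrix_of_hasLaw_multivariateGaussian
    (Matrix.PosSemidef.one.smul (sq_nonneg σN)) hNlaw
  have hP2 := integral_mul_of_covMatrix hPm hPm hP0 hPcov
  have hN2 := integral_mul_of_covMatrix hNm hNm hN0 hNcov
  have hVP2 := integral_mul_of_covMatrix hVm hPm hV0 hVPcov
  have hvarP : ∀ i, Var[fun ω => P ω i; μ] = σP ^ 2 := fun i => by
    have h1 := congrFun (congrFun hPcov i) i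
    simp only [covMatrix, Matrix.of_apply, Matrix.smul_apply, Matrix.one_apply_eq] at h1
    rw [covariance_self (hPm i).memLp_two.1.aemeasurable] at h1
    simpa using h1
  -- If `σP = 0`, then `P 0` vanishes a.s. and cannot be correlated with `V 0`.
  have hσP : σP ^ 2 ≠ 0 := by
    intro h0
    have h1 := ae_eq_integral_of_variance_eq_zero (hPm 0).memLp_two ((hvarP 0).trans h0)
    have h2 := hVP2 0 0
    rw [if_pos rfl] at h2
    apply hρ
    rw [← h2]
    refine integral_eq_zero_of_ae ?_
    filter_upwards [h1] with ω hω
    rw [hω, hP0]; simp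
  have hc : ρ / σP ^ 2 ≠ 0 := div_ne_zero hρ hσP
  have hresid := indepFun_residual hPV hPcov hVPcov (div_mul_cancel₀ ρ hσP).symm
  have hradial := integral_norm_pow_mul_radialVelocity hP hV hPV hP0 hV0 hresid
  have hsymPV := identDistrib_neg_of_hasGaussianLaw hPV (by
    rw [integral_pair hPV.fst.integrable hPV.snd.integrable, hPmean, hVmean]; rfl)
  have hsymNε : IdentDistrib (fun ω => (N ω, ε ω)) (fun ω => (-N ω, ε ω)) μ μ :=
    (identDistrib_neg_of_hasGaussianLaw hNG hNmean).prodMk (.refl hε.aemeasurable) hNε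
      (hNε.comp measurable_neg measurable_id)
  have hsym := hsymPV.prodMk hsymNε hindep
    (hindep.comp measurable_neg (measurable_neg.prodMap measurable_id))
  -- The radial velocity is unchanged when `P` and `V` both change sign.
  have hsym' := hsym.comp (u := fun q : (E3 × E3) × (E3 × ℝ) =>
    ((q.1.1, (inner ℝ (lineOfSight q.1.1) q.1.2 : ℝ)), q.2)) (by fun_prop)
  simp only [Function.comp_def, Prod.fst_neg, Prod.snd_neg, lineOfSight_neg, inner_neg_neg]
    at hsym'
  have hind := hindep.comp (φ := fun q : E3 × E3 =>
    (q.1, (inner ℝ (lineOfSight q.1) q.2 : ℝ))) (by fun_prop) measurable_id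
  have hnot : ¬ ∃ w, bayesEstimator μ P (observation P V N ε) =ᵐ[μ]
      affineFamily (observation P V N ε) w := by
    rintro ⟨⟨a, b, A⟩, h⟩
    have hkey := integral_sq_mul_eq_of_bayesEstimator_affine hP hN (by fun_prop) hε hPm hNm hXm hεm
      hind hNε hsym' hεmean hP2 hN2 (pow_pos hσN 2).ne' a b A h
    have hsum : ∫ ω, ‖P ω‖ ^ 2 * inner ℝ (lineOfSight (P ω)) (V ω) ∂μ =
        3 * σP ^ 2 * ∫ ω, inner ℝ (lineOfSight (P ω)) (V ω) ∂μ := by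
      simp_rw [EuclideanSpace.real_norm_sq_eq, Finset.sum_mul]
      rw [integral_finsetSum _ fun i _ => (((hPm i).pow 2).mul hXm).integrable]
      simp only [hkey, Finset.sum_const, Finset.card_univ, Fintype.card_fin, nsmul_eq_mul]
      push_cast; ring
    have hnorm : ∫ ω, ‖P ω‖ ^ 2 ∂μ = 3 * σP ^ 2 := by
      simp_rw [EuclideanSpace.real_norm_sq_eq]
      rw [integral_finsetSum _ fun i _ => ((hPm i).pow 2).integrable]
      simp only [sq (_ : ℝ), hP2, if_true]
      simp
    have h0 := hradial 0
    simp only [pow_zero, one_mul, zero_add, pow_one] at h0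
    -- Now `hsum` reads `c 𝔼[R³] = 𝔼[R²] (c 𝔼[R])`.
    rw [hradial 2, h0, ← hnorm] at hsum
    refine integral_sq_mul_integral_ne (hasMoments_norm hPV.fst) (fun ω => norm_nonneg _)
      (not_norm_ae_eq_const hPV.fst 0 (by rwa [hvarP])) (mul_left_cancel₀ hc ?_)
    linear_combination hsum
  have hZ : Measurable (observation P V N ε) := by
    unfold observation; fun_prop
  refine ⟨fun ⟨f, hf, h⟩ => ?_, ?_⟩
  · obtain ⟨w, hw⟩ := exists_affineFamily_eq (observation P V N ε) hf
    exact hnot ⟨w, hw ▸ h⟩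
  · refine (lintegral_sub_condExp_lt_iInf hZ.comap_le hPV.fst.memLp_two
      (affineFamily (observation P V N ε))
      (memLp_two_affineFamily (hPV.fst.memLp_two.add hNG.memLp_two) (hXm.add hεm).memLp_two)
      (fun w => ((measurable_affine w).comp
        (comap_measurable _)).stronglyMeasurable.aestronglyMeasurable) hnot).trans_le ?_
    refine le_iInf₂ fun f hf => ?_
    obtain ⟨w, hw⟩ := exists_affineFamily_eq (observation P V N ε) hf
    rw [hw]
    exact iInf_le _ w
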